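/- Call a set $K \subset \mathbb{R}$ a Cantor set if it is homeomorphic to the classical middle-thirds Cantor set. For a bounded set $A \subset \mathbb{R}$ and $\varepsilon > 0$ let $N(A,\varepsilon)$ be the least number of closed balls of radius $\varepsilon$ that cover $A$, and let $\overline{\dim}_M A = \inf\{ s \ge 0 : \lim_{\varepsilon \to 0+} N(A,\varepsilon)\,\varepsilon^s = 0\}$ be its upper Minkowski (box-counting) dimension. The packing dimension of a set $A \subset \mathbb{R}$ is $$\dim_p A = \inf\Big\{ \sup_{i} \overline{\dim}_M A_i : A = \bigcup_{i=0}^{\infty} A_i,\ \text{each } A_i \text{ bounded} \Big\}.$$ Theorem. Let $K \subset \mathbb{R}$ be a Cantor set with $\dim_p K < 1/2$. Then there exists a set $X \subset \mathbb{R}$ of positive Lebesgue outer measure such that $|K \cap (X+t)| \le 1$ for every $t \in \mathbb{R}$, where $X + t = \{x + t : x \in X\}$. -/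

import Mathlib

open scoped ENNReal NNReal Topology

/-- A set of reals is a Cantor set if it is homeomorphic to the classical middle-thirds
Cantor set. -/
def IsCantorSet (K : Set ℝ) : Prop :=
  Nonempty (K ≃ₜ cantorSet)

/-- The upper Minkowski (box-counting) dimension
`inf {s ≥ 0 : N(A, ε) * ε ^ s → 0 as ε ↓ 0}`, where `N(A, ε)` is the least number of closed balls
of radius `ε` that cover `A` (it is `∞` if there is no finite cover). -/
noncomputable def upperMinkowskiDim {E : Type*} [PseudoMetricSpace E] (A : Set E) : ℝ≥0∞ :=
  ⨅ (s : ℝ≥0) (_ : Filter.Tendsto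
      (fun ε : ℝ≥0 => (Metric.externalCoveringNumber ε A : ℝ≥0∞) * (ε : ℝ≥0∞) ^ (s : ℝ))
      (𝓝[>] 0) (𝓝 0)), (s : ℝ≥0∞)

/-- The packing dimension
`inf {sup_i upperMinkowskiDim (F i) : A = ⋃ i, F i, each F i bounded}`, the infimum being over all
sequences of bounded sets with union `A`. -/
noncomputable def packingDim {E : Type*} [PseudoMetricSpace E] (A : Set E) : ℝ≥0∞ :=
  ⨅ (F : ℕ → Set E) (_ : (∀ i, Bornology.IsBounded (F i)) ∧ A = ⋃ i, F i),
    ⨆ i, upperMinkowskiDim (F i)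

/-! With `D = K - K`, it suffices to find `X` of positive outer measure with `x - y ∉ D` for
distinct `x, y ∈ X`. Such an `X` is built by transfinite recursion so as to meet every compact set
`P` of positive measure. There are at most continuum many such `P`, so each step needs only that
fewer than `𝔠` translates of `D` never cover `P` (`exists_mem_forall_sub_notMem`).

The dimension hypothesis makes `D` a countable union of pieces of box dimension at most `2s < 1`.
The `n`-tuples lying in a common translate of `D` then have dimension at most `2sn + 1`, the extra
`1` coming from the translation. For large `n` this is less than `n`, so these tuples form a null
set, which is closed because `D` is compact. Mycielski's theorem, applied inside the support of
Lebesgue measure on `P`, gives a continuous map of the Cantor space into `P` under which each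
translate of `D` captures fewer than `n` points. Fewer than `𝔠` translates thus capture fewer than
`𝔠` points, and one point escapes. -/

open Set Cardinal in
/-- If every member of a family `P` of sets contains a point related to all points of any given set
of cardinality less than that of the family, then some set of pairwise related points meets every
member of the family. -/
theorem exists_pairwise_forall_inter_nonempty.{u} {α ι : Type u} {r : α → α → Prop}
    (hr : ∀ x y, r x y → r y x) (P : ι → Set α)
    (h : ∀ S : Set α, #S < #ι → ∀ i, ∃ x ∈ P i, ∀ s ∈ S, r x s) :
    ∃ X : Set α, X.Pairwise r ∧ ∀ i, (X ∩ P i).Nonempty := by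
  -- A well-order of least type: every proper initial segment has cardinality below `#ι`, so `h`
  -- applies to the points already chosen.
  obtain ⟨_, _, hord⟩ := exists_ord_eq_type_lt ι
  have key : ∀ (i : ι) (g : ∀ j, j < i → α), ∃ x ∈ P i, ∀ j (hj : j < i), r x (g j hj) := by
    intro i g
    obtain ⟨x, hxP, hx⟩ := h (range fun j : Iio i => g j.1 j.2)
      (mk_range_le.trans_lt (mk_Iio_lt i hord)) i
    exact ⟨x, hxP, fun j hj => hx _ ⟨⟨j, hj⟩, rfl⟩⟩
  choose F hFmem hFr using key
  let g : ι → α := (wellFounded_lt (α := ι)).fix F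
  have hg : ∀ i, g i = F i fun j _ => g j := fun i => WellFounded.fix_eq _ _ _
  have hlt : ∀ i j, j < i → r (g i) (g j) := fun i j hj => by
    rw [hg i]; exact hFr i _ j hj
  refine ⟨range g, ?_, fun i => ⟨g i, ⟨_, rfl⟩, ?_⟩⟩
  · rintro _ ⟨i, rfl⟩ _ ⟨j, rfl⟩ hne
    rcases lt_trichotomy i j with hij | rfl | hij
    · exact hr _ _ (hlt _ _ hij)
    · exact absurd rfl hne
    · exact hlt _ _ hij
  · rw [hg]; exact hFmem _ _

/-! ### Mycielski's theorem by Baire category in the space of continuous maps. -/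

section Mycielski

/-- The first `k` entries of a binary sequence. -/
def binaryPrefix (k : ℕ) (x : ℕ → Bool) : Fin k → Bool := fun i => x i

theorem continuous_binaryPrefix (k : ℕ) : Continuous (binaryPrefix k) :=
  continuous_pi fun i => continuous_apply (i : ℕ)

theorem binaryPrefix_eq_of_le {k m : ℕ} (hkm : k ≤ m) {x y : ℕ → Bool}
    (h : binaryPrefix m x = binaryPrefix m y) : binaryPrefix k x = binaryPrefix k y :=
  funext fun i => congrFun h ⟨i, i.2.trans_le hkm⟩

theorem exists_forall_binaryPrefix_eq_dist_lt {E : Type*} [PseudoMetricSpace E]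
    (f : C(ℕ → Bool, E)) {ε : ℝ} (hε : 0 < ε) :
    ∃ m, ∀ x y, binaryPrefix m x = binaryPrefix m y → dist (f x) (f y) < ε := by
  let _ : MetricSpace (ℕ → Bool) := PiNat.metricSpaceOfDiscreteUniformity (fun _ => rfl)
  have huc := CompactSpace.uniformContinuous_of_continuous f.continuous
  obtain ⟨δ, hδ, h⟩ := Metric.uniformContinuous_iff.1 huc ε hε
  obtain ⟨m, hm⟩ := exists_pow_lt_of_lt_one hδ (by norm_num : (1 / 2 : ℝ) < 1)
  refine ⟨m, fun x y hxy => h ?_⟩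
  refine lt_of_le_of_lt ?_ hm
  rw [← PiNat.mem_cylinder_iff_dist_le]
  exact fun i hi => congrFun hxy ⟨i, hi⟩

variable {E : Type*} [MetricSpace E] {n : ℕ} {R : Set (Fin n → E)}

/-- A closed set of `n`-tuples with dense complement is avoided, after a small perturbation, by
all `n`-tuples of distinct entries of a given finite family. -/
theorem dense_setOf_forall_injective_notMem [CompleteSpace E] {ι : Type*} [Finite ι]
    (hR : IsClosed R) (hRd : Dense Rᶜ) :
    Dense {y : ι → E | ∀ σ : Fin n → ι, Function.Injective σ → y ∘ σ ∉ R} := by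
  cases nonempty_fintype ι
  have heq : {y : ι → E | ∀ σ : Fin n → ι, Function.Injective σ → y ∘ σ ∉ R} =
      ⋂ σ : {σ : Fin n → ι // Function.Injective σ}, {y | y ∘ σ.1 ∈ Rᶜ} := by
    ext y; simp
  rw [heq]
  refine dense_iInter_of_isOpen (fun σ => ?_) fun σ => ?_
  · exact hR.isOpen_compl.preimage (continuous_pi fun i => continuous_apply (σ.1 i))
  · rw [Metric.dense_iff]
    intro y ε hε
    obtain ⟨z, hz, hzR⟩ := Metric.dense_iff.1 hRd (y ∘ σ.1) ε hε
    refine ⟨Function.extend σ.1 z y, ?_, ?_⟩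
    · rw [Metric.mem_ball, dist_pi_lt_iff hε] at hz ⊢
      intro i
      by_cases hi : ∃ j, σ.1 j = i
      · obtain ⟨j, rfl⟩ := hi
        rw [σ.2.extend_apply]
        exact hz j
      · rw [Function.extend_apply' _ _ _ hi, dist_self]
        exact hε
    · have : Function.extend σ.1 z y ∘ σ.1 = z := Function.extend_comp σ.2 z y
      simpa [this] using hzR

/-- Separation at a fixed level `k` is a clopen condition, unlike mere distinctness. The bad pairs
(points, map) are therefore closed, and projecting along the compact space of points keeps them
closed. -/
theorem isOpen_setOf_forall_injective_binaryPrefix_notMem (hR : IsClosed R) (k : ℕ) :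
    IsOpen {f : C(ℕ → Bool, E) | ∀ x : Fin n → ℕ → Bool,
      Function.Injective (fun i => binaryPrefix k (x i)) → (fun i => f (x i)) ∉ R} := by
  have hcl : IsClosed {p : (Fin n → ℕ → Bool) × C(ℕ → Bool, E) |
      Function.Injective (fun i => binaryPrefix k (p.1 i)) ∧ (fun i => p.2 (p.1 i)) ∈ R} := by
    refine IsClosed.inter ?_ (hR.preimage ?_)
    · have hc : Continuous fun p : (Fin n → ℕ → Bool) × C(ℕ → Bool, E) =>
          fun i => binaryPrefix k (p.1 i) :=
        continuous_pi fun i => (continuous_binaryPrefix k).comp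
          ((continuous_apply i).comp continuous_fst)
      exact (isClosed_discrete {q : Fin n → Fin k → Bool | Function.Injective q}).preimage hc
    · fun_prop
  have := (isClosedMap_snd_of_compactSpace _ hcl).isOpen_compl
  convert this using 1
  ext f
  simp

/-- By uniform continuity `f` is close to a map depending on finitely many bits; its finitely many
values are then perturbed into general position. -/
theorem dense_setOf_forall_injective_binaryPrefix_notMem [CompleteSpace E]
    (hR : IsClosed R) (hRd : Dense Rᶜ) (k : ℕ) :
    Dense {f : C(ℕ → Bool, E) | ∀ x : Fin n → ℕ → Bool,
      Function.Injective (fun i => binaryPrefix k (x i)) → (fun i => f (x i)) ∉ R} := by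
  rw [Metric.dense_iff]
  intro f ε hε
  obtain ⟨m₀, hm₀⟩ := exists_forall_binaryPrefix_eq_dist_lt f (half_pos hε)
  let m := max m₀ k
  let e : (Fin m → Bool) → ℕ → Bool := fun s i => if h : i < m then s ⟨i, h⟩ else false
  have he : ∀ x, binaryPrefix m (e (binaryPrefix m x)) = binaryPrefix m x := by
    intro x; ext i; simp [binaryPrefix, e]
  obtain ⟨z, hz, hzR⟩ := Metric.dense_iff.1
    (dense_setOf_forall_injective_notMem (ι := Fin m → Bool) hR hRd) (fun s => f (e s)) (ε / 2)
    (half_pos hε)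
  rw [Metric.mem_ball, dist_pi_lt_iff (half_pos hε)] at hz
  refine ⟨⟨fun x => z (binaryPrefix m x),
    continuous_of_discreteTopology.comp (continuous_binaryPrefix m)⟩, ?_, ?_⟩
  · rw [Metric.mem_ball, ContinuousMap.dist_lt_iff hε]
    intro x
    calc dist (z (binaryPrefix m x)) (f x)
        ≤ dist (z (binaryPrefix m x)) (f (e (binaryPrefix m x)))
          + dist (f (e (binaryPrefix m x))) (f x) := dist_triangle _ _ _
      _ < ε / 2 + ε / 2 :=
          add_lt_add (hz _) (hm₀ _ _ (binaryPrefix_eq_of_le (le_max_left _ _) (he x)))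
      _ = ε := add_halves ε
  · intro x hx
    refine hzR (fun i => binaryPrefix m (x i)) fun i j hij => hx ?_
    exact binaryPrefix_eq_of_le (le_max_right m₀ k) hij

/-- Mycielski's theorem for a closed relation: a closed set of `n`-tuples with dense complement
is avoided by the tuples of values of some continuous map on the Cantor space at distinct points. -/
theorem exists_continuousMap_forall_injective_notMem [CompleteSpace E] [Nonempty E]
    (hR : IsClosed R) (hRd : Dense Rᶜ) :
    ∃ f : C(ℕ → Bool, E), ∀ x : Fin n → ℕ → Bool, Function.Injective x →
      (fun i => f (x i)) ∉ R := by
  have hd := dense_iInter_of_isOpen_nat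
    (isOpen_setOf_forall_injective_binaryPrefix_notMem hR)
    (dense_setOf_forall_injective_binaryPrefix_notMem hR hRd)
  have : Nonempty C(ℕ → Bool, E) := ⟨ContinuousMap.const _ (Classical.arbitrary E)⟩
  obtain ⟨f, hf⟩ := hd.nonempty
  refine ⟨f, fun x hx => ?_⟩
  -- Finitely many distinct sequences are already separated by prefixes of one common length.
  have hev : ∀ᶠ k in Filter.atTop, ∀ i j, i ≠ j → binaryPrefix k (x i) ≠ binaryPrefix k (x j) := by
    simp only [Filter.eventually_all]
    intro i j hij
    obtain ⟨a, ha⟩ := Function.ne_iff.1 (hx.ne hij)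
    filter_upwards [Filter.eventually_gt_atTop a] with k hk h
    exact ha (congrFun h ⟨a, hk⟩)
  obtain ⟨k, hk⟩ := hev.exists
  refine Set.mem_iInter.1 hf k x fun i j hij => ?_
  by_contra hne
  exact hk i j hne hij

end Mycielski

open Cardinal Set in
/-- Fewer than continuum many sets cannot cover the range of a map on the Cantor space if each of
them contains the values of the map at fewer than `n` points. -/
theorem exists_forall_notMem_of_mk_lt_continuum {E ι : Type} (f : (ℕ → Bool) → E) (n : ℕ)
    (A : ι → Set E) (hι : #ι < 𝔠)
    (h : ∀ i, ∀ x : Fin n → ℕ → Bool, Function.Injective x → ∃ j, f (x j) ∉ A i) :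
    ∃ x, ∀ i, f x ∉ A i := by
  by_contra! hcon
  have hfin : ∀ i, (f ⁻¹' A i).Finite := by
    intro i
    by_contra hinf
    let φ := Set.Infinite.natEmbedding _ hinf
    obtain ⟨j, hj⟩ := h i (fun j : Fin n => (φ j : ℕ → Bool)) fun a b hab =>
      Fin.ext (φ.injective (Subtype.ext hab))
    exact hj (φ j).2
  have huniv : (univ : Set (ℕ → Bool)) = ⋃ i, f ⁻¹' A i := by
    symm; rw [eq_univ_iff_forall]; intro x; simpa using hcon x
  have hcard : #(univ : Set (ℕ → Bool)) = 𝔠 := by simp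
  refine absurd hcard (ne_of_lt ?_)
  rw [huniv]
  calc #(⋃ i, f ⁻¹' A i) ≤ #ι * ⨆ i, #(f ⁻¹' A i) := mk_iUnion_le _
    _ ≤ #ι * ℵ₀ := by
        gcongr
        exact ciSup_le' fun i => (hfin i).lt_aleph0.le
    _ < 𝔠 := mul_lt_of_lt aleph0_le_continuum hι aleph0_lt_continuum

/-! ### Box-counting estimates for tuples in a common translate. -/

section Nets

open Filter MeasureTheory Set

/-- At all small scales `ε`, the set `A` has a net of mesh `a * ε` with at most `ε ^ (-s)` points. -/
def HasSmallNets (a s : ℝ) (A : Set ℝ) : Prop :=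
  ∀ᶠ ε : ℝ in 𝓝[>] 0, ∃ C : Finset ℝ, (C.card : ℝ) ≤ ε ^ (-s) ∧
    ∀ x ∈ A, ∃ c ∈ C, |x - c| ≤ a * ε

theorem HasSmallNets.sub {a b s t : ℝ} {A B : Set ℝ} (hA : HasSmallNets a s A)
    (hB : HasSmallNets b t B) : HasSmallNets (a + b) (s + t) (Set.image2 (· - ·) A B) := by
  filter_upwards [hA, hB, self_mem_nhdsWithin] with ε ⟨C, hC, hAC⟩ ⟨D, hD, hBD⟩ hε
  rw [mem_Ioi] at hε
  classical
  refine ⟨(C ×ˢ D).image fun p => p.1 - p.2, ?_, ?_⟩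
  · calc (((C ×ˢ D).image fun p => p.1 - p.2).card : ℝ) ≤ (C ×ˢ D).card := by
          exact_mod_cast Finset.card_image_le
      _ = C.card * D.card := by rw [Finset.card_product]; push_cast; rfl
      _ ≤ ε ^ (-s) * ε ^ (-t) := by gcongr
      _ = ε ^ (-(s + t)) := by rw [← Real.rpow_add hε]; ring_nf
  · rintro _ ⟨x, hx, y, hy, rfl⟩
    obtain ⟨c, hc, hxc⟩ := hAC x hx
    obtain ⟨d, hd, hyd⟩ := hBD y hy
    refine ⟨c - d, Finset.mem_image.2 ⟨(c, d), Finset.mk_mem_product hc hd, rfl⟩, ?_⟩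
    rw [abs_le] at *
    constructor <;> dsimp only <;> linarith

theorem hasSmallNets_of_upperMinkowskiDim_lt {A : Set ℝ} {s : ℝ≥0}
    (h : upperMinkowskiDim A < s) : HasSmallNets 1 s A := by
  simp only [upperMinkowskiDim, iInf_lt_iff] at h
  obtain ⟨s', hs', hlt⟩ := h
  have hlt' : (s' : ℝ) < s := by exact_mod_cast hlt
  have htend : Tendsto Real.toNNReal (𝓝[>] 0) (𝓝[>] 0) := by
    refine tendsto_nhdsWithin_iff.2 ⟨?_, ?_⟩
    · have := (continuous_real_toNNReal.tendsto 0).mono_left (nhdsWithin_le_nhds (s := Ioi 0))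
      simpa using this
    · filter_upwards [self_mem_nhdsWithin] with ε hε
      simpa using hε
  have hev := (htend.eventually (hs'.eventually (gt_mem_nhds zero_lt_one)))
  have hone : ∀ᶠ ε : ℝ in 𝓝[>] 0, ε < 1 :=
    (gt_mem_nhds (zero_lt_one (α := ℝ))).filter_mono nhdsWithin_le_nhds
  filter_upwards [hev, hone, self_mem_nhdsWithin] with ε hN hε1 hε
  rw [mem_Ioi] at hε
  have hεnn : ε.toNNReal ≠ 0 := by simpa using hε
  have hpow : (ε.toNNReal : ℝ≥0∞) ^ (s' : ℝ) ≠ 0 := by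
    simp [ENNReal.rpow_eq_zero_iff, hε]
  have hNtop : Metric.externalCoveringNumber ε.toNNReal A ≠ ⊤ := by
    intro htop
    rw [htop, ENat.toENNReal_top, ENNReal.top_mul hpow] at hN
    exact absurd hN (by simp)
  obtain ⟨C, hC, hCcard⟩ : ∃ C : Set ℝ, Metric.IsCover ε.toNNReal A C ∧
      C.encard ≤ Metric.externalCoveringNumber ε.toNNReal A := by
    -- Adding one to the finite covering number gives a strict inequality, from which an optimal
    -- cover is extracted.
    have hlt : Metric.externalCoveringNumber ε.toNNReal A <
        Metric.externalCoveringNumber ε.toNNReal A + 1 := ENat.lt_add_one_iff hNtop |>.2 le_rfl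
    conv_lhs at hlt => rw [Metric.externalCoveringNumber]
    simp only [iInf_lt_iff] at hlt
    obtain ⟨C, hC, h⟩ := hlt
    exact ⟨C, hC, (ENat.lt_add_one_iff hNtop).1 h⟩
  have hfin : C.Finite := Set.encard_ne_top_iff.1 (ne_top_of_le_ne_top hNtop hCcard)
  refine ⟨hfin.toFinset, ?_, fun x hx => ?_⟩
  · have h1 : ((hfin.toFinset.card : ℕ) : ℝ≥0∞) * (ε.toNNReal : ℝ≥0∞) ^ (s' : ℝ) ≤ 1 := by
      refine le_trans ?_ hN.le
      gcongr
      rw [hfin.encard_eq_coe_toFinset_card] at hCcard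
      exact_mod_cast ENat.toENNReal_le.2 hCcard
    have h2 : (hfin.toFinset.card : ℝ) * ε ^ (s' : ℝ) ≤ 1 := by
      rw [← ENNReal.coe_rpow_of_ne_zero hεnn] at h1
      have h3 : ((hfin.toFinset.card : ℕ) : ℝ≥0) * ε.toNNReal ^ (s' : ℝ) ≤ 1 := by
        exact_mod_cast h1
      have h4 := NNReal.coe_le_coe.2 h3
      simpa [Real.coe_toNNReal ε hε.le] using h4
    calc (hfin.toFinset.card : ℝ) ≤ ε ^ (-(s' : ℝ)) := by
          rw [Real.rpow_neg hε.le, ← one_div, le_div_iff₀ (by positivity)]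
          exact h2
      _ ≤ ε ^ (-(s : ℝ)) :=
          Real.rpow_le_rpow_of_exponent_ge hε hε1.le (by linarith)
  · obtain ⟨c, hc, hxc⟩ := hC hx
    refine ⟨c, by simpa using hc, ?_⟩
    have : edist x c ≤ ε.toNNReal := hxc
    rw [edist_nndist, ENNReal.coe_le_coe, ← NNReal.coe_le_coe, coe_nndist,
      Real.coe_toNNReal ε hε.le, Real.dist_eq] at this
    simpa using this

theorem exists_iUnion_hasSmallNets_of_packingDim_lt {K : Set ℝ} {d : ℝ≥0}
    (h : packingDim K < d) :
    ∃ (s : ℝ) (F : ℕ → Set ℝ), s < d ∧ K = ⋃ i, F i ∧ ∀ i, HasSmallNets 1 s (F i) := by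
  simp only [packingDim, iInf_lt_iff] at h
  obtain ⟨F, ⟨-, hF⟩, hlt⟩ := h
  obtain ⟨s, hs, hsd⟩ := ENNReal.lt_iff_exists_nnreal_btwn.1 hlt
  exact ⟨s, F, by exact_mod_cast hsd, hF, fun i =>
    hasSmallNets_of_upperMinkowskiDim_lt ((le_iSup _ i).trans_lt hs)⟩

/-- The tuples in a translate, along the diagonal, of a product of sets with small nets form a null
set, as soon as the product has dimension less than `n - 1`. -/
theorem volume_diagonal_translates_eq_zero {n : ℕ} {s T : ℝ} (hT : 0 ≤ T) (hs : n * s + 1 < n)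
    {D : Fin n → Set ℝ} (hD : ∀ i, HasSmallNets 2 s (D i)) :
    volume {p : Fin n → ℝ | ∃ t ∈ Icc (-T) T, ∀ i, p i - t ∈ D i} = 0 := by
  set Z := {p : Fin n → ℝ | ∃ t ∈ Icc (-T) T, ∀ i, p i - t ∈ D i}
  have hone : ∀ᶠ ε : ℝ in 𝓝[>] 0, ε < 1 :=
    (gt_mem_nhds (zero_lt_one (α := ℝ))).filter_mono nhdsWithin_le_nhds
  have hbound : ∀ᶠ ε : ℝ in 𝓝[>] 0,
      volume Z ≤ ENNReal.ofReal ((2 * T + 2) * 6 ^ n * ε ^ (n - n * s - 1 : ℝ)) := by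
    filter_upwards [eventually_all.2 hD, hone, self_mem_nhdsWithin] with ε hC hε1 hε
    rw [mem_Ioi] at hε
    choose C hCcard hC using hC
    -- Translations are rounded down to multiples of `ε`, costing about `2T / ε` positions.
    let J : Finset ℤ := Finset.Icc ⌊-T / ε⌋ ⌊T / ε⌋
    have hJ : (J.card : ℝ) ≤ (2 * T + 2) * ε ^ (-1 : ℝ) := by
      have h1 : ⌊-T / ε⌋ ≤ ⌊T / ε⌋ + 1 := by
        have : ⌊-T / ε⌋ ≤ ⌊T / ε⌋ := Int.floor_le_floor (by gcongr; linarith)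
        linarith
      have h2 : (J.card : ℝ) = ⌊T / ε⌋ + 1 - ⌊-T / ε⌋ := by
        have := Int.card_Icc_of_le _ _ h1
        exact_mod_cast this
      have h3 := Int.floor_le (T / ε)
      have h4 := Int.lt_floor_add_one (-T / ε)
      have h5 : (2 * T + 2) * ε ^ (-1 : ℝ) = T / ε - -T / ε + 2 * ε⁻¹ := by
        rw [Real.rpow_neg_one]; field_simp; ring
      have h6 : 1 ≤ ε⁻¹ := (one_le_inv₀ hε).2 hε1.le
      rw [h2, h5]; linarith
    -- The radius `3 * ε` is `2 * ε` from the nets plus `ε` from rounding `t`.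
    have hcover : Z ⊆ ⋃ q ∈ Fintype.piFinset C ×ˢ J,
        Metric.closedBall (fun i => q.1 i + q.2 * ε) (3 * ε) := by
      rintro p ⟨t, ht, hp⟩
      choose c hc hpc using fun i => hC i _ (hp i)
      have hj1 := Int.floor_le (t / ε)
      have hj2 := Int.lt_floor_add_one (t / ε)
      rw [le_div_iff₀ hε] at hj1
      rw [div_lt_iff₀ hε] at hj2
      simp only [mem_iUnion]
      refine ⟨(c, ⌊t / ε⌋), ?_, ?_⟩
      · refine Finset.mk_mem_product (Fintype.mem_piFinset.2 hc) (Finset.mem_Icc.2 ⟨?_, ?_⟩)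
        · exact Int.floor_le_floor (by gcongr; exact ht.1)
        · exact Int.floor_le_floor (by gcongr; exact ht.2)
      · rw [Metric.mem_closedBall, dist_pi_le_iff (by positivity)]
        intro i
        rw [Real.dist_eq]
        have := hpc i
        rw [abs_le] at this ⊢
        constructor <;> dsimp only <;> linarith
    have hcard : ((Fintype.piFinset C ×ˢ J).card : ℝ) ≤
        (ε ^ (-s)) ^ n * ((2 * T + 2) * ε ^ (-1 : ℝ)) := by
      rw [Finset.card_product, Fintype.card_piFinset]
      push_cast
      gcongr
      calc ∏ i, ((C i).card : ℝ) ≤ ∏ _i : Fin n, ε ^ (-s) :=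
            Finset.prod_le_prod (fun _ _ => by positivity) fun i _ => hCcard i
        _ = (ε ^ (-s)) ^ n := by simp
    calc volume Z ≤ ∑ q ∈ Fintype.piFinset C ×ˢ J,
          volume (Metric.closedBall (fun i => q.1 i + q.2 * ε) (3 * ε)) :=
          (measure_mono hcover).trans (measure_biUnion_finset_le _ _)
      _ = ENNReal.ofReal ((Fintype.piFinset C ×ˢ J).card * (2 * (3 * ε)) ^ n) := by
          rw [Finset.sum_congr rfl fun q _ => Real.volume_pi_closedBall _ (by positivity)]
          simp only [Finset.sum_const, nsmul_eq_mul, Fintype.card_fin]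
          rw [ENNReal.ofReal_mul (by positivity), ENNReal.ofReal_natCast]
      _ ≤ ENNReal.ofReal ((2 * T + 2) * 6 ^ n * ε ^ (n - n * s - 1 : ℝ)) := by
          refine ENNReal.ofReal_le_ofReal ?_
          calc ((Fintype.piFinset C ×ˢ J).card : ℝ) * (2 * (3 * ε)) ^ n
              ≤ (ε ^ (-s)) ^ n * ((2 * T + 2) * ε ^ (-1 : ℝ)) * (2 * (3 * ε)) ^ n := by gcongr
            _ = (2 * T + 2) * 6 ^ n * ((ε ^ (-s)) ^ n * ε ^ (-1 : ℝ) * ε ^ n) := by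
                rw [show 2 * (3 * ε) = 6 * ε by ring, mul_pow]; ring
            _ = (2 * T + 2) * 6 ^ n * ε ^ (n - n * s - 1 : ℝ) := by
                rw [← Real.rpow_natCast (ε ^ (-s)), ← Real.rpow_mul hε.le, ← Real.rpow_add hε,
                  ← Real.rpow_natCast ε, ← Real.rpow_add hε]
                congr 2
                ring
  have hlim : Tendsto (fun ε : ℝ => ENNReal.ofReal
      ((2 * T + 2) * 6 ^ n * ε ^ (n - n * s - 1 : ℝ))) (𝓝[>] 0) (𝓝 0) := by
    have hpos : (0 : ℝ) < n - n * s - 1 := by linarith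
    have h1 : Tendsto (fun ε : ℝ => (2 * T + 2) * 6 ^ n * ε ^ (n - n * s - 1 : ℝ)) (𝓝[>] 0)
        (𝓝 ((2 * T + 2) * 6 ^ n * (0 : ℝ) ^ (n - n * s - 1 : ℝ))) :=
      ((Real.continuousAt_rpow_const _ _ (Or.inr hpos.le)).tendsto.mono_left
        nhdsWithin_le_nhds).const_mul _
    rw [Real.zero_rpow hpos.ne', mul_zero] at h1
    simpa using ENNReal.tendsto_ofReal h1
  exact le_antisymm (ge_of_tendsto hlim hbound) zero_le

theorem volume_diagonal_translates_iUnion_eq_zero {n : ℕ} {s : ℝ} (hs : n * s + 1 < n)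
    {κ : Type*} [Countable κ] {D : κ → Set ℝ} (hD : ∀ q, HasSmallNets 2 s (D q)) :
    volume {p : Fin n → ℝ | ∃ t, ∀ i, p i - t ∈ ⋃ q, D q} = 0 := by
  -- Different coordinates may fall in different pieces, so `a` records a piece for each; `N` bounds
  -- the translation.
  refine measure_mono_null (t := ⋃ (a : Fin n → κ) (N : ℕ),
    {p : Fin n → ℝ | ∃ t ∈ Icc (-(N : ℝ)) N, ∀ i, p i - t ∈ D (a i)}) ?_ ?_
  · rintro p ⟨t, ht⟩
    simp only [mem_iUnion] at ht
    choose a ha using ht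
    obtain ⟨N, hN⟩ := exists_nat_ge |t|
    simp only [mem_iUnion]
    exact ⟨a, N, t, abs_le.1 hN, ha⟩
  · exact measure_iUnion_null fun a => measure_iUnion_null fun N =>
      volume_diagonal_translates_eq_zero (Nat.cast_nonneg N) hs fun i => hD (a i)

/-- The set is the sum of the compact power of `D` and the closed diagonal line. -/
theorem isClosed_diagonal_translates {n : ℕ} {D : Set ℝ} (hD : IsCompact D) :
    IsClosed {p : Fin n → ℝ | ∃ t, ∀ i, p i - t ∈ D} := by
  have hdiag : IsClosed (range fun (t : ℝ) (_ : Fin n) => t) := by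
    have : range (fun (t : ℝ) (_ : Fin n) => t) =
        ⋂ (i : Fin n) (j : Fin n), {q : Fin n → ℝ | q i = q j} := by
      ext q
      simp only [mem_range, mem_iInter, mem_ofPred_eq]
      constructor
      · rintro ⟨t, rfl⟩ i j; rfl
      · intro h
        rcases n with _ | n
        · exact ⟨0, funext fun i => i.elim0⟩
        · exact ⟨q 0, funext fun i => h 0 i⟩
    rw [this]
    exact isClosed_iInter fun i => isClosed_iInter fun j =>
      isClosed_eq (continuous_apply i) (continuous_apply j)
  have hcpt : IsCompact (Set.univ.pi fun _ : Fin n => D) := isCompact_univ_pi fun _ => hD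
  convert hdiag.add_left_of_isCompact hcpt using 1
  ext p
  simp only [Set.mem_add, mem_range, mem_ofPred_eq]
  constructor
  · rintro ⟨t, ht⟩
    exact ⟨fun i => p i - t, fun i _ => ht i, _, ⟨t, rfl⟩, by ext i; simp⟩
  · rintro ⟨c, hc, _, ⟨t, rfl⟩, rfl⟩
    exact ⟨t, fun i => by simpa using hc i (mem_univ i)⟩

end Nets

/-! ### Covering compact sets of positive measure by translates. -/

section Translates

open MeasureTheory Set

/-- A null set of `n`-tuples of reals has dense complement in the tuples from the support of
Lebesgue measure restricted to a given set. -/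
theorem dense_compl_preimage_support_restrict {n : ℕ} {P : Set ℝ}
    {R : Set (Fin n → ℝ)} (hR : volume R = 0) :
    Dense ((fun (y : Fin n → (volume.restrict P).support) i => (y i : ℝ)) ⁻¹' R)ᶜ := by
  set μ := volume.restrict P
  rw [Metric.dense_iff]
  intro y ε hε
  by_contra hcon
  rw [not_nonempty_iff_eq_empty, Set.eq_empty_iff_forall_notMem] at hcon
  have hsub : (Set.univ.pi fun i => Metric.ball (y i : ℝ) ε ∩ μ.support) ⊆ R := by
    intro p hp
    by_contra hpR
    refine hcon (fun i => ⟨p i, (hp i (mem_univ i)).2⟩) ⟨?_, hpR⟩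
    rw [Metric.mem_ball, dist_pi_lt_iff hε]
    exact fun i => (hp i (mem_univ i)).1
  -- Removing the complement of the support costs no measure, so every relatively open piece of the
  -- support has positive Lebesgue measure.
  have hpos : ∀ i, 0 < volume (Metric.ball (y i : ℝ) ε ∩ μ.support) := by
    intro i
    have h1 : 0 < μ (Metric.ball (y i : ℝ) ε) :=
      (Measure.mem_support_iff_forall _).1 (y i).2 _ (Metric.ball_mem_nhds _ hε)
    rw [← measure_inter_add_sdiff _ (Measure.isClosed_support (μ := μ)).measurableSet,
      measure_mono_null (s := _ \ _) (fun x hx => hx.2) (Measure.measure_compl_support (μ := μ)),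
      add_zero] at h1
    exact h1.trans_le (Measure.restrict_apply_le _ _)
  have hzero := measure_mono_null hsub hR
  rw [volume_pi_pi, Finset.prod_eq_zero_iff] at hzero
  obtain ⟨i, -, hi⟩ := hzero
  exact (hpos i).ne' hi

open Cardinal in
/-- Fewer than continuum many translates of a compact set `D` do not cover a compact set of positive
measure, if almost no `n`-tuple is contained in a translate of `D`. -/
theorem exists_mem_forall_sub_notMem {n : ℕ} {D P S : Set ℝ} (hD : IsCompact D)
    (hnull : volume {p : Fin n → ℝ | ∃ t, ∀ i, p i - t ∈ D} = 0)
    (hP : IsCompact P) (hPpos : 0 < volume P) (hS : #S < 𝔠) :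
    ∃ x ∈ P, ∀ s ∈ S, x - s ∉ D := by
  have hsP : (volume.restrict P).support ⊆ P :=
    Measure.support_subset_of_isClosed hP.isClosed (ae_restrict_mem hP.measurableSet)
  have hne : Nonempty (volume.restrict P).support := by
    rw [nonempty_coe_sort, Measure.nonempty_support_iff, Ne, Measure.restrict_eq_zero]
    exact hPpos.ne'
  have : CompleteSpace (volume.restrict P).support :=
    Measure.isClosed_support.completeSpace_coe
  obtain ⟨f, hf⟩ := exists_continuousMap_forall_injective_notMem
    ((isClosed_diagonal_translates (n := n) hD).preimage
      (f := fun (y : Fin n → (volume.restrict P).support) i => (y i : ℝ)) (by fun_prop))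
    (dense_compl_preimage_support_restrict hnull)
  obtain ⟨x, hx⟩ := exists_forall_notMem_of_mk_lt_continuum (fun x => (f x : ℝ)) n
    (fun s : S => {y | y - s ∈ D}) hS fun s x hx => by
      by_contra! hcon
      exact hf x hx ⟨s, hcon⟩
  exact ⟨f x, hsP (f x).2, fun s hs => hx ⟨s, hs⟩⟩

open Cardinal in
theorem mk_setOf_isCompact_le_continuum : #{P : Set ℝ | IsCompact P} ≤ 𝔠 :=
  by
  obtain ⟨b, hb, hgen⟩ := MeasurableSpace.CountablyGenerated.isCountablyGenerated (α := ℝ)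
  have hle := MeasurableSpace.cardinal_measurableSet_le_continuum
    (hb.le_aleph0.trans aleph0_le_continuum)
  rw [← hgen] at hle
  exact (mk_le_mk_of_subset fun _ hP => IsCompact.measurableSet hP).trans hle

/-- If `X` were null, the complement of a measurable null hull would contain, by inner regularity, a
compact set of positive measure missing `X`. -/
theorem volume_pos_of_forall_inter_nonempty {X : Set ℝ}
    (h : ∀ P : Set ℝ, IsCompact P → 0 < volume P → (X ∩ P).Nonempty) : 0 < volume X := by
  rw [pos_iff_ne_zero]
  intro h0
  have hpos : 0 < volume (toMeasurable volume X)ᶜ := by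
    rw [pos_iff_ne_zero, Ne, measure_eq_zero_iff_ae_notMem]
    intro hae
    have h1 : volume (toMeasurable volume X) = 0 := by rwa [measure_toMeasurable]
    rw [measure_eq_zero_iff_ae_notMem] at h1
    obtain ⟨x, hx, hx'⟩ := (hae.and h1).exists
    exact hx hx'
  obtain ⟨P, hPsub, hP, hPpos⟩ :=
    (measurableSet_toMeasurable volume X).compl.exists_lt_isCompact hpos
  obtain ⟨x, hxX, hxP⟩ := h P hP hPpos
  exact hPsub hxP (subset_toMeasurable _ _ hxX)

theorem IsCantorSet.isCompact {K : Set ℝ} (hK : IsCantorSet K) : IsCompact K := by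
  obtain ⟨e⟩ := hK
  have : CompactSpace cantorSet := isCompact_iff_compactSpace.1 isCompact_cantorSet
  exact isCompact_iff_compactSpace.2 e.symm.compactSpace

end Translates

/-! ### The main theorem. -/

open MeasureTheory Set in
theorem mainTheorem3 (K : Set ℝ) (hK : IsCantorSet K) (hdim : packingDim K < 1 / 2) :
    ∃ X : Set ℝ, 0 < MeasureTheory.volume X ∧
      ∀ t : ℝ, (K ∩ ((fun x : ℝ => x + t) '' X)).encard ≤ 1 := by
  obtain ⟨s, F, hs, hKF, hF⟩ := exists_iUnion_hasSmallNets_of_packingDim_lt (d := 1 / 2)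
    (hdim.trans_eq (by simp))
  have hs : s < 1 / 2 := by simpa using hs
  -- Since `s + s < 1`, this is exactly the condition `n * (s + s) + 1 < n`.
  obtain ⟨n, hn⟩ := exists_nat_gt (1 - (s + s))⁻¹
  have hn : n * (s + s) + 1 < n := by
    rw [inv_lt_iff_one_lt_mul₀ (by linarith)] at hn
    linarith
  have hDU : Set.image2 (· - ·) K K = ⋃ q : ℕ × ℕ, Set.image2 (· - ·) (F q.1) (F q.2) := by
    conv_lhs => rw [hKF]
    rw [image2_iUnion_left, iUnion_prod']
    simp only [image2_iUnion_right]
  have hD : IsCompact (Set.image2 (· - ·) K K) := by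
    rw [← image_prod]
    exact (hK.isCompact.prod hK.isCompact).image continuous_sub
  have hnull : volume {p : Fin n → ℝ | ∃ t, ∀ i, p i - t ∈ Set.image2 (· - ·) K K} = 0 := by
    rw [hDU]
    refine volume_diagonal_translates_iUnion_eq_zero hn fun q => ?_
    have := (hF q.1).sub (hF q.2)
    rwa [one_add_one_eq_two] at this
  obtain ⟨X, hX, hXP⟩ := exists_pairwise_forall_inter_nonempty
    (r := fun x y : ℝ => x - y ∉ Set.image2 (· - ·) K K)
    (fun x y h ⟨a, ha, b, hb, hab⟩ => h ⟨b, hb, a, ha, by dsimp only at hab ⊢; linarith⟩)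
    (fun P : {P : Set ℝ | IsCompact P ∧ 0 < volume P} => (P : Set ℝ)) fun S hS P =>
      exists_mem_forall_sub_notMem hD hnull P.2.1 P.2.2 <| hS.trans_le <|
        (Cardinal.mk_le_mk_of_subset fun _ hP => hP.1).trans mk_setOf_isCompact_le_continuum
  refine ⟨X, volume_pos_of_forall_inter_nonempty fun P hP hpos => hXP ⟨P, hP, hpos⟩, fun t => ?_⟩
  rw [encard_le_one_iff]
  rintro _ _ ⟨hxK, x, hx, rfl⟩ ⟨hyK, y, hy, rfl⟩
  by_contra hne
  -- Two common points `x + t`, `y + t` would put `x - y` in `K - K`.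
  exact hX hx hy (fun h => hne (by rw [h])) ⟨_, hxK, _, hyK, by simp⟩
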